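/- **Theorem (starvation freedom).** Let the set of processes be any subset of $\mathbb N$ (finite or infinite), and let $AE$ be any fixed set of processes (those that may be aborted). Consider the following transition system. *State.* Each process $p$ has a program counter $pc.p\in\mathbb N$, finite sets of processes $nbh.p$, $prio.p$, $before.p$, $after.p$, $wack.p$, $away.p$, $need.p$, $prom.p$, and integers $fork.p.q$ for all processes $q$. For each of the five message types $m\in\{notify,withdraw,ack,req,gra\}$ and all processes $q,r$, the number $m.q.r\in\mathbb N$ counts the messages $m$ in transit from $q$ to $r$. Initially all $pc.p=11$, all sets are empty, all $m.q.r=0$, and $fork.q.r=1$ if $r<q$ and $fork.q.r=0$ otherwise. Below, private variables without an index are those of $p$, "send $m$ to $S$" means increment $m.p.q$ for every $q\in S$, and $nbh^{>}=\{q\in nbh\mid p<q\}$. Each guarded alternative is one atomic step. *Environment steps* $env(p)$: - $pc=11$: choose any finite set $nbh$ with $p\notin nbh$; $pc:=12$. - $pc=12$ and $p\in AE$: $nbh:=\emptyset$; $pc:=11$. - $pc=13$ and $p\in AE$: send $withdraw$ to $nbh$; $wack:=nbh$; $nbh:=\emptyset$; $prio:=\emptyset$; $pc:=11$. - $pc=14$,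 $need\cap\{q\mid p<q\}=\emptyset$ and $p\in AE$: send $gra$ to $nbh^{>}$ and decrement $fork.p.q$ for all $q\in nbh^{>}$; send $withdraw$ to $nbh$; $wack:=nbh$; $need:=\emptyset$; $nbh:=\emptyset$; $pc:=11$. *Forward steps* $fwd(p)$: - $pc=12$ and $wack=\emptyset$: send $notify$ to $nbh$; $prio:=nbh\cap(before\setminus after)$; $pc:=13$. - $pc=13$ and $prio=\emptyset$: send $req$ to $nbh^{>}$; $need:=\{q\in nbh\mid p<q\lor q\in away\}$; $pc:=14$. - $pc=14$ and $need=\emptyset$: send $withdraw$ to $nbh$; $wack:=nbh$; $pc:=15$. - $pc=15$: (critical section) $pc:=16$. - $pc=16$: send $gra$ to $nbh^{>}$ and decrement $fork.p.q$ for all $q\in nbh^{>}$; $nbh:=\emptyset$; $pc:=11$. *Receive steps* $rec(m,q,p)$ of $p$ from $q$, with seven alternatives $m$: - $notify$: if $notify.q.p>0$, decrement it; add $q$ to $before$. - $withdraw$: if $withdraw.q.p>0$, decrement it; remove $q$ from $prio$; add $q$ to $after$. - $after$: if $q\in after\cap before$, remove $q$ from $after$ and $before$; send $ack$ to $\{q\}$.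 - $ack$: if $ack.q.p>0$, decrement it; remove $q$ from $wack$. - $req$: if $req.q.p>0$, decrement it; add $q$ to $prom$. - $gra$: if $gra.q.p>0$, decrement it; increment $fork.p.q$; remove $q$ from $away$ and $need$. - $prom$: if $q\in prom\setminus away$ and not ($pc\ge 15$ and $q\in nbh$), send $gra$ to $\{q\}$; decrement $fork.p.q$; add $q$ to $away$; remove $q$ from $prom$; if $pc=14$ and $q\in nbh$, add $q$ to $need$. *Executions.* The relation $step$ is the union of the identity relation and of all relations $env(p)$, $fwd(p)$, $rec(m,q,p)$. For a set $U$ of states, $[U]$ is the set of infinite state sequences $xs$ with $xs(0)\in U$; for a relation $R$ on states, $[R]_2$ is the set of those with $(xs(0),xs(1))\in R$. For a set $Q$ of state sequences, $\Box Q$ (resp. $\Diamond Q$) is the set of sequences all of whose (resp. at least one of whose) tails $n\mapsto xs(k+n)$, $k\in\mathbb N$, belong to $Q$. The set of executions is $Ex=[\{\text{initial state}\}]\cap\Box[step]_2$. With $D(R)=\{x\mid\forall y:(x,y)\notin R\}$, weak fairness for $R$ is $wf(R)=\Box\Diamond[D(R)]\cup\Box\Diamond[R]_2$, and the set of globally weakly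 fair executions is $$WF=Ex\cap\bigcap_p wf(fwd(p))\cap\bigcap_{p,q,m}wf(rec(m,q,p)).$$ *Claim.* For every process $p$, $\;WF\subseteq\Box\Diamond[\,pc.p=11\,]$; that is, in every globally weakly fair execution, every process is infinitely often at the idle line 11. -/

import Mathlib

namespace PartialMX

/-! Temporal logic over infinite state sequences. -/

section Temporal

variable {X : Type*}

/-- The sequences that start in `U`. -/
def sem1 (U : Set X) : Set (ℕ → X) := {xs | xs 0 ∈ U}

/-- The sequences whose first two states are related by `R`. -/
def sem2 (R : X → X → Prop) : Set (ℕ → X) := {xs | R (xs 0) (xs 1)}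

/-- The sequence with its first `k` states dropped. -/
def shift (k : ℕ) (xs : ℕ → X) : ℕ → X := fun n => xs (k + n)

/-- Always. -/
def box (Q : Set (ℕ → X)) : Set (ℕ → X) := {xs | ∀ k, shift k xs ∈ Q}

/-- Eventually. -/
def diamond (Q : Set (ℕ → X)) : Set (ℕ → X) := {xs | ∃ k, shift k xs ∈ Q}

/-- The states in which no step of `R` is possible. -/
def disabled (R : X → X → Prop) : Set X := {x | ∀ y, ¬ R x y}

/-- Weak fairness for `R`: infinitely often disabled or infinitely often taken. -/
def wf (R : X → X → Prop) : Set (ℕ → X) :=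
  box (diamond (sem1 (disabled R))) ∪ box (diamond (sem2 R))

end Temporal

/-! The algorithm, for processes of type `P`. -/

/-- Global states. For a message type `m`, the number of messages `m` in transit from `q` to `r`
is `m q r`; a private variable `v` of process `q` is `v q`. -/
@[ext]
structure State (P : Type*) where
  fork : P → P → ℤ
  req : P → P → ℕ
  gra : P → P → ℕ
  notify : P → P → ℕ
  withdraw : P → P → ℕ
  ack : P → P → ℕ
  pc : P → ℕ
  nbh : P → Finset P
  prio : P → Finset P
  before : P → Finset P
  after : P → Finset P
  wack : P → Finset P
  away : P → Finset P
  need : P → Finset P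
  prom : P → Finset P

section Algorithm

variable {P : Type*} [LinearOrder P]

/-- Process `p` sends one message to every member of `S`. -/
def send (m : P → P → ℕ) (p : P) (S : Finset P) : P → P → ℕ :=
  fun a b => if a = p ∧ b ∈ S then m a b + 1 else m a b

/-- One message from `q` to `p` is removed (used only when there is one). -/
def receive (m : P → P → ℕ) (q p : P) : P → P → ℕ :=
  fun a b => if a = q ∧ b = p then m a b - 1 else m a b

/-- Process `p` gives up one fork to every member of `S`. -/
def dropFork (f : P → P → ℤ) (p : P) (S : Finset P) : P → P → ℤ :=
  fun a b => if a = p ∧ b ∈ S then f a b - 1 else f a b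

/-- Process `p` gains one fork shared with `q`. -/
def gainFork (f : P → P → ℤ) (p q : P) : P → P → ℤ :=
  fun a b => if a = p ∧ b = q then f a b + 1 else f a b

/-- The higher neighbours of `p`. -/
def State.higherNbh (x : State P) (p : P) : Finset P := (x.nbh p).filter (fun q => p < q)

/-- The initial state, with the forks by default at the higher process. -/
def initState : State P where
  fork := fun q r => if r < q then 1 else 0
  req := fun _ _ => 0
  gra := fun _ _ => 0
  notify := fun _ _ => 0
  withdraw := fun _ _ => 0
  ack := fun _ _ => 0
  pc := fun _ => 11
  nbh := fun _ => ∅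
  prio := fun _ => ∅
  before := fun _ => ∅
  after := fun _ => ∅
  wack := fun _ => ∅
  away := fun _ => ∅
  need := fun _ => ∅
  prom := fun _ => ∅

/-- The environment triggers the idle process `p`, giving it some finite set of neighbours. -/
def env11 (p : P) (x y : State P) : Prop :=
  x.pc p = 11 ∧ ∃ S : Finset P, p ∉ S ∧
    y = { x with
      nbh := Function.update x.nbh p S
      pc := Function.update x.pc p 12 }

/-- Abortion at line 12; `AE` is the set of the processes that may be aborted. -/
def env12 (AE : Set P) (p : P) (x y : State P) : Prop :=
  x.pc p = 12 ∧ p ∈ AE ∧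
    y = { x with
      nbh := Function.update x.nbh p ∅
      pc := Function.update x.pc p 11 }

/-- Abortion at line 13. -/
def env13 (AE : Set P) (p : P) (x y : State P) : Prop :=
  x.pc p = 13 ∧ p ∈ AE ∧
    y = { x with
      withdraw := send x.withdraw p (x.nbh p)
      wack := Function.update x.wack p (x.nbh p)
      nbh := Function.update x.nbh p ∅
      prio := Function.update x.prio p ∅
      pc := Function.update x.pc p 11 }

/-- Abortion at line 14. -/
def env14 (AE : Set P) (p : P) (x y : State P) : Prop :=
  x.pc p = 14 ∧ (∀ q ∈ x.need p, ¬ p < q) ∧ p ∈ AE ∧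
    y = { x with
      gra := send x.gra p (x.higherNbh p)
      fork := dropFork x.fork p (x.higherNbh p)
      withdraw := send x.withdraw p (x.nbh p)
      wack := Function.update x.wack p (x.nbh p)
      need := Function.update x.need p ∅
      nbh := Function.update x.nbh p ∅
      pc := Function.update x.pc p 11 }

/-- The environment steps for process `p`. -/
def env (AE : Set P) (p : P) (x y : State P) : Prop :=
  env11 p x y ∨ env12 AE p x y ∨ env13 AE p x y ∨ env14 AE p x y

def fwd12 (p : P) (x y : State P) : Prop :=
  x.pc p = 12 ∧ x.wack p = ∅ ∧
    y = { x with
      notify := send x.notify p (x.nbh p)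
      prio := Function.update x.prio p (x.nbh p ∩ (x.before p \ x.after p))
      pc := Function.update x.pc p 13 }

def fwd13 (p : P) (x y : State P) : Prop :=
  x.pc p = 13 ∧ x.prio p = ∅ ∧
    y = { x with
      req := send x.req p (x.higherNbh p)
      need := Function.update x.need p ((x.nbh p).filter (fun q => p < q ∨ q ∈ x.away p))
      pc := Function.update x.pc p 14 }

def fwd14 (p : P) (x y : State P) : Prop :=
  x.pc p = 14 ∧ x.need p = ∅ ∧
    y = { x with
      withdraw := send x.withdraw p (x.nbh p)
      wack := Function.update x.wack p (x.nbh p)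
      pc := Function.update x.pc p 15 }

/-- Execution of the critical section. -/
def fwd15 (p : P) (x y : State P) : Prop :=
  x.pc p = 15 ∧
    y = { x with pc := Function.update x.pc p 16 }

def fwd16 (p : P) (x y : State P) : Prop :=
  x.pc p = 16 ∧
    y = { x with
      gra := send x.gra p (x.higherNbh p)
      fork := dropFork x.fork p (x.higherNbh p)
      nbh := Function.update x.nbh p ∅
      pc := Function.update x.pc p 11 }

/-- The forward steps of process `p`. -/
def fwd (p : P) (x y : State P) : Prop :=
  fwd12 p x y ∨ fwd13 p x y ∨ fwd14 p x y ∨ fwd15 p x y ∨ fwd16 p x y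

/-- The seven alternatives of the receiving component: the five message types, and the two
alternatives `after` and `prom` that are not triggered by the presence of a message. -/
inductive Alt
  | notify | withdraw | after | ack | req | gra | prom

/-- The steps of alternative `m` of the component of `p` that receives messages from `q`. -/
def rcv (m : Alt) (q p : P) (x y : State P) : Prop :=
  match m with
  | .notify => 0 < x.notify q p ∧
      y = { x with
        notify := receive x.notify q p
        before := Function.update x.before p (insert q (x.before p)) }
  | .withdraw => 0 < x.withdraw q p ∧
      y = { x with
        withdraw := receive x.withdraw q p
        prio := Function.update x.prio p ((x.prio p).erase q)
        after := Function.update x.after p (insert q (x.after p)) }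
  | .after => q ∈ x.after p ∩ x.before p ∧
      y = { x with
        after := Function.update x.after p ((x.after p).erase q)
        before := Function.update x.before p ((x.before p).erase q)
        ack := send x.ack p {q} }
  | .ack => 0 < x.ack q p ∧
      y = { x with
        ack := receive x.ack q p
        wack := Function.update x.wack p ((x.wack p).erase q) }
  | .req => 0 < x.req q p ∧
      y = { x with
        req := receive x.req q p
        prom := Function.update x.prom p (insert q (x.prom p)) }
  | .gra => 0 < x.gra q p ∧
      y = { x with
        gra := receive x.gra q p
        fork := gainFork x.fork p q
        away := Function.update x.away p ((x.away p).erase q)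
        need := Function.update x.need p ((x.need p).erase q) }
  | .prom => q ∈ x.prom p \ x.away p ∧ ¬ (15 ≤ x.pc p ∧ q ∈ x.nbh p) ∧
      y = { x with
        gra := send x.gra p {q}
        fork := dropFork x.fork p {q}
        away := Function.update x.away p (insert q (x.away p))
        prom := Function.update x.prom p ((x.prom p).erase q)
        need := Function.update x.need p
          (if x.pc p = 14 ∧ q ∈ x.nbh p then insert q (x.need p) else x.need p) }

/-- The steps of process `p`. -/
def stepOf (AE : Set P) (p : P) (x y : State P) : Prop :=
  env AE p x y ∨ fwd p x y ∨ ∃ q m, rcv m q p x y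

/-- The (reflexive) step relation of the system. -/
def step (AE : Set P) (x y : State P) : Prop :=
  x = y ∨ ∃ p, stepOf AE p x y

/-- The executions. -/
def Ex (AE : Set P) : Set (ℕ → State P) :=
  sem1 {initState} ∩ box (sem2 (step AE))

/-- The globally weakly fair executions. -/
def WF (AE : Set P) : Set (ℕ → State P) :=
  Ex AE ∩ (⋂ p : P, wf (fwd p)) ∩ ⋂ (p : P) (q : P) (m : Alt), wf (rcv m q p)

/-- The states in which process `p` is at line `k`. -/
def atLine (p : P) (k : ℕ) : Set (State P) := {x | x.pc p = k}

end Algorithm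

end PartialMX

/-!
The paths of a process through the algorithm only lead from line 11 up to line 16 and back to 11.
Hence a process that is not infinitely often at line 11 eventually remains at one line between 12
and 16 (`exists_eventually_pc_eq`), and it suffices to exclude each of these lines. By weak fairness
of the forward steps this amounts to showing that the guard of the line eventually holds forever
(`not_eventually_fwd_enabled`). Lines 15 and 16 have no guard.

The remaining lines rest on a safety invariant (`Invariant`), which counts the messages and flags of
the two handshakes between each pair of processes, and on the following principle: a predicate that
is eventually stable along a run either eventually always holds or eventually never holds
(`eventually_or_eventually_not`). The invariant then tells where the single token of a handshake
permanently rests, and fairness of the receiving steps contradicts that.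

* Line 12. A process that awaits an acknowledgement from `q` has a notification and a withdrawal
  outstanding at `q`. Both arrive, so `q` acknowledges (`eventually_notMem_wack`).
* Line 14, by induction on the process `p` in the well-founded order. While `p` stays at line 14,
  its notification at a neighbour `q` is never withdrawn, so that `q` can pass line 13 with `p`
  among its neighbours at most once more: it must wait for `p` afterwards. Thus either `q`
  eventually never competes with `p` at line 14 or later, or `q` itself gets stuck at line 13 or 14
  (`eventually_overtake`). For `p < q` this means that the promise of `q` to `p` is eventually
  always enabled, so that `p` gets the fork for good. For `q < p`, the process `q` is not stuck at
  line 14 by induction, so that it eventually never claims the fork, which then stays with `p`.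
* Line 13, by induction on the time `k` from which on `p` remains at line 13. Such a process waits
  forever for some process `q`, which must have notified `p` before `p` entered line 13, and which
  never withdraws. So `q` remains at line 13 or 14, and in fact at line 13, from a time before `k`
  (`not_forall_pc_eq_thirteen`).
-/

namespace PartialMX

open Filter

variable {P : Type*} [LinearOrder P]

/-! ### Safety invariant -/

/-- The safety invariant. The four equations count, for an ordered pair of processes, the tokens of
the two handshakes that the pair runs; every term is at most one.
* `notify_count`, `withdraw_count`: a notification of `r` by `q` is in transit, then remembered in
  `before r`, then turned into an acknowledgement; likewise for the withdrawal and `after r`. The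
  notification is outstanding while `q` competes with `r` at line 13 or 14 or awaits the
  acknowledgement, the withdrawal only in the latter case.
* `req_count`, `away_count`, for `q < r`: while `q` needs the fork of `r`, there is exactly one
  request, promise or grant; and `r` has its fork away exactly while a grant is in transit between
  the two or `q` holds the fork at line 14 or later. -/
structure Invariant (x : State P) : Prop where
  pc_ge : ∀ p, 11 ≤ x.pc p
  pc_le : ∀ p, x.pc p ≤ 16
  self_notMem_nbh : ∀ p, p ∉ x.nbh p
  wack_eq_empty : ∀ p, x.pc p = 13 ∨ x.pc p = 14 → x.wack p = ∅
  prio_eq_empty : ∀ p, x.pc p ≠ 13 → x.prio p = ∅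
  prio_before : ∀ p, ∀ q ∈ x.prio p, q ∈ x.before p ∧ q ∉ x.after p
  notify_count : ∀ q r, x.notify q r + (if q ∈ x.before r then 1 else 0) + x.ack r q =
    (if (x.pc q = 13 ∨ x.pc q = 14) ∧ r ∈ x.nbh q then 1 else 0) +
      (if r ∈ x.wack q then 1 else 0)
  withdraw_count : ∀ q r, x.withdraw q r + (if q ∈ x.after r then 1 else 0) + x.ack r q =
    (if r ∈ x.wack q then 1 else 0)
  need_nbh : ∀ p, ∀ q ∈ x.need p, x.pc p = 14 ∧ q ∈ x.nbh p
  need_away : ∀ p, ∀ q ∈ x.need p, q < p → q ∈ x.away p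
  req_lt : ∀ q r, 0 < x.req q r → q < r
  prom_lt : ∀ r, ∀ q ∈ x.prom r, q < r
  req_count : ∀ q r, q < r → x.req q r + (if q ∈ x.prom r then 1 else 0) + x.gra r q =
    (if r ∈ x.need q then 1 else 0)
  away_count : ∀ q r, q < r →
    (if q ∈ x.away r then 1 else 0) + (if r ∈ x.need q then 1 else 0) =
      x.gra r q + x.gra q r + (if 14 ≤ x.pc q ∧ r ∈ x.nbh q then 1 else 0)

theorem invariant_initState : Invariant (initState : State P) := by
  constructor <;> simp [initState]

/-! ### Case distinction over the steps -/

/-- Case distinction over the atomic steps, with the new state substituted. The motive depends on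
the proof of the step so that `cases` accepts that proof as its target. -/
theorem step_cases {AE : Set P} {x : State P}
    {motive : (y : State P) → step AE x y → Prop}
    (refl : ∀ hs, motive x hs)
    (env11 : ∀ p (S : Finset P), x.pc p = 11 → p ∉ S →
      ∀ hs, motive { x with
        nbh := Function.update x.nbh p S
        pc := Function.update x.pc p 12 } hs)
    (env12 : ∀ p, x.pc p = 12 → p ∈ AE →
      ∀ hs, motive { x with
        nbh := Function.update x.nbh p ∅
        pc := Function.update x.pc p 11 } hs)
    (env13 : ∀ p, x.pc p = 13 → p ∈ AE →
      ∀ hs, motive { x with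
        withdraw := send x.withdraw p (x.nbh p)
        wack := Function.update x.wack p (x.nbh p)
        nbh := Function.update x.nbh p ∅
        prio := Function.update x.prio p ∅
        pc := Function.update x.pc p 11 } hs)
    (env14 : ∀ p, x.pc p = 14 → (∀ q ∈ x.need p, ¬ p < q) → p ∈ AE →
      ∀ hs, motive { x with
        gra := send x.gra p (x.higherNbh p)
        fork := dropFork x.fork p (x.higherNbh p)
        withdraw := send x.withdraw p (x.nbh p)
        wack := Function.update x.wack p (x.nbh p)
        need := Function.update x.need p ∅
        nbh := Function.update x.nbh p ∅
        pc := Function.update x.pc p 11 } hs)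
    (fwd12 : ∀ p, x.pc p = 12 → x.wack p = ∅ →
      ∀ hs, motive { x with
        notify := send x.notify p (x.nbh p)
        prio := Function.update x.prio p (x.nbh p ∩ (x.before p \ x.after p))
        pc := Function.update x.pc p 13 } hs)
    (fwd13 : ∀ p, x.pc p = 13 → x.prio p = ∅ →
      ∀ hs, motive { x with
        req := send x.req p (x.higherNbh p)
        need := Function.update x.need p ((x.nbh p).filter (fun q => p < q ∨ q ∈ x.away p))
        pc := Function.update x.pc p 14 } hs)
    (fwd14 : ∀ p, x.pc p = 14 → x.need p = ∅ →
      ∀ hs, motive { x with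
        withdraw := send x.withdraw p (x.nbh p)
        wack := Function.update x.wack p (x.nbh p)
        pc := Function.update x.pc p 15 } hs)
    (fwd15 : ∀ p, x.pc p = 15 →
      ∀ hs, motive { x with
        pc := Function.update x.pc p 16 } hs)
    (fwd16 : ∀ p, x.pc p = 16 →
      ∀ hs, motive { x with
        gra := send x.gra p (x.higherNbh p)
        fork := dropFork x.fork p (x.higherNbh p)
        nbh := Function.update x.nbh p ∅
        pc := Function.update x.pc p 11 } hs)
    (rcv_notify : ∀ q p, 0 < x.notify q p →
      ∀ hs, motive { x with
        notify := receive x.notify q p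
        before := Function.update x.before p (insert q (x.before p)) } hs)
    (rcv_withdraw : ∀ q p, 0 < x.withdraw q p →
      ∀ hs, motive { x with
        withdraw := receive x.withdraw q p
        prio := Function.update x.prio p ((x.prio p).erase q)
        after := Function.update x.after p (insert q (x.after p)) } hs)
    (rcv_after : ∀ q p, q ∈ x.after p ∩ x.before p →
      ∀ hs, motive { x with
        after := Function.update x.after p ((x.after p).erase q)
        before := Function.update x.before p ((x.before p).erase q)
        ack := send x.ack p {q} } hs)
    (rcv_ack : ∀ q p, 0 < x.ack q p →
      ∀ hs, motive { x with
        ack := receive x.ack q p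
        wack := Function.update x.wack p ((x.wack p).erase q) } hs)
    (rcv_req : ∀ q p, 0 < x.req q p →
      ∀ hs, motive { x with
        req := receive x.req q p
        prom := Function.update x.prom p (insert q (x.prom p)) } hs)
    (rcv_gra : ∀ q p, 0 < x.gra q p →
      ∀ hs, motive { x with
        gra := receive x.gra q p
        fork := gainFork x.fork p q
        away := Function.update x.away p ((x.away p).erase q)
        need := Function.update x.need p ((x.need p).erase q) } hs)
    (rcv_prom : ∀ q p, q ∈ x.prom p \ x.away p → ¬ (15 ≤ x.pc p ∧ q ∈ x.nbh p) →
      ∀ hs, motive { x with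
        gra := send x.gra p {q}
        fork := dropFork x.fork p {q}
        away := Function.update x.away p (insert q (x.away p))
        prom := Function.update x.prom p ((x.prom p).erase q)
        need := Function.update x.need p
          (if x.pc p = 14 ∧ q ∈ x.nbh p then insert q (x.need p) else x.need p) } hs)
    {y : State P} (h : step AE x y) : motive y h := by
  rcases h with rfl | ⟨p, (⟨h, S, hS, rfl⟩ | ⟨h, hA, rfl⟩ | ⟨h, hA, rfl⟩ | ⟨h, hn, hA, rfl⟩) |
    (⟨h, hw, rfl⟩ | ⟨h, hp, rfl⟩ | ⟨h, hn, rfl⟩ | ⟨h, rfl⟩ | ⟨h, rfl⟩) | ⟨q, m, h⟩⟩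
  · exact refl _
  · exact env11 p S h hS _
  · exact env12 p h hA _
  · exact env13 p h hA _
  · exact env14 p h hn hA _
  · exact fwd12 p h hw _
  · exact fwd13 p h hp _
  · exact fwd14 p h hn _
  · exact fwd15 p h _
  · exact fwd16 p h _
  cases m with
  | prom => obtain ⟨hq, hn, rfl⟩ := h; exact rcv_prom q p hq hn _
  | notify => obtain ⟨hq, rfl⟩ := h; exact rcv_notify q p hq _
  | withdraw => obtain ⟨hq, rfl⟩ := h; exact rcv_withdraw q p hq _
  | after => obtain ⟨hq, rfl⟩ := h; exact rcv_after q p hq _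
  | ack => obtain ⟨hq, rfl⟩ := h; exact rcv_ack q p hq _
  | req => obtain ⟨hq, rfl⟩ := h; exact rcv_req q p hq _
  | gra => obtain ⟨hq, rfl⟩ := h; exact rcv_gra q p hq _

/-! ### Preservation of the invariant -/

/-- Each part of the invariant is preserved by every step. -/
theorem step_pc_ge {AE : Set P} {x y : State P} (h : step AE x y) (hx : Invariant x) (p : P) :
    11 ≤ y.pc p := by
  have h0 := hx.pc_ge p
  cases h using step_cases <;>
    grind (splits := 20) [Function.update_apply, send, receive, State.higherNbh]

theorem step_pc_le {AE : Set P} {x y : State P} (h : step AE x y) (hx : Invariant x) (p : P) :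
    y.pc p ≤ 16 := by
  have h0 := hx.pc_le p
  cases h using step_cases <;>
    grind (splits := 20) [Function.update_apply, send, receive, State.higherNbh]

theorem step_self_notMem_nbh {AE : Set P} {x y : State P} (h : step AE x y) (hx : Invariant x)
    (p : P) : p ∉ y.nbh p := by
  have h0 := hx.self_notMem_nbh p
  cases h using step_cases <;>
    grind (splits := 20) [Function.update_apply, send, receive, State.higherNbh]

theorem step_wack_eq_empty {AE : Set P} {x y : State P} (h : step AE x y) (hx : Invariant x)
    (p : P) : y.pc p = 13 ∨ y.pc p = 14 → y.wack p = ∅ := by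
  have h0 := hx.wack_eq_empty p
  cases h using step_cases <;>
    grind (splits := 20) [Function.update_apply, send, receive, State.higherNbh]

theorem step_prio_eq_empty {AE : Set P} {x y : State P} (h : step AE x y) (hx : Invariant x)
    (p : P) : y.pc p ≠ 13 → y.prio p = ∅ := by
  have h0 := hx.prio_eq_empty p
  cases h using step_cases <;>
    grind (splits := 20) [Function.update_apply, send, receive, State.higherNbh]

theorem step_prio_before {AE : Set P} {x y : State P} (h : step AE x y) (hx : Invariant x)
    (p q : P) : q ∈ y.prio p → q ∈ y.before p ∧ q ∉ y.after p := by
  have h0 := hx.prio_before p q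
  cases h using step_cases <;>
    grind (splits := 20) [Function.update_apply, send, receive, State.higherNbh]

theorem step_notify_count {AE : Set P} {x y : State P} (h : step AE x y) (hx : Invariant x)
    (q r : P) : y.notify q r + (if q ∈ y.before r then 1 else 0) + y.ack r q =
      (if (y.pc q = 13 ∨ y.pc q = 14) ∧ r ∈ y.nbh q then 1 else 0) +
        (if r ∈ y.wack q then 1 else 0) := by
  have h0 := hx.notify_count q r
  have h1 := hx.withdraw_count q r
  have h2 := hx.wack_eq_empty q
  cases h using step_cases <;>
    grind (splits := 20) [Function.update_apply, send, receive, State.higherNbh]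

theorem step_withdraw_count {AE : Set P} {x y : State P} (h : step AE x y) (hx : Invariant x)
    (q r : P) : y.withdraw q r + (if q ∈ y.after r then 1 else 0) + y.ack r q =
      (if r ∈ y.wack q then 1 else 0) := by
  have h0 := hx.withdraw_count q r
  have h1 := hx.wack_eq_empty q
  cases h using step_cases <;>
    grind (splits := 20) [Function.update_apply, send, receive, State.higherNbh]

theorem step_need_nbh {AE : Set P} {x y : State P} (h : step AE x y) (hx : Invariant x) (p q : P) :
    q ∈ y.need p → y.pc p = 14 ∧ q ∈ y.nbh p := by
  have h0 := hx.need_nbh p q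
  cases h using step_cases <;>
    grind (splits := 20) [Function.update_apply, send, receive, State.higherNbh]

theorem step_need_away {AE : Set P} {x y : State P} (h : step AE x y) (hx : Invariant x) (p q : P) :
    q ∈ y.need p → q < p → q ∈ y.away p := by
  have h0 := hx.need_away p q
  cases h using step_cases <;>
    grind (splits := 20) [Function.update_apply, send, receive, State.higherNbh]

theorem step_req_lt {AE : Set P} {x y : State P} (h : step AE x y) (hx : Invariant x) (q r : P) :
    0 < y.req q r → q < r := by
  have h0 := hx.req_lt q r
  cases h using step_cases <;>
    grind (splits := 20) [Function.update_apply, send, receive, State.higherNbh]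

theorem step_prom_lt {AE : Set P} {x y : State P} (h : step AE x y) (hx : Invariant x) (r q : P) :
    q ∈ y.prom r → q < r := by
  have h0 := hx.prom_lt r q
  have h1 := hx.req_lt q r
  cases h using step_cases <;>
    grind (splits := 20) [Function.update_apply, send, receive, State.higherNbh]

theorem step_req_count {AE : Set P} {x y : State P} (h : step AE x y) (hx : Invariant x)
    (q r : P) (hqr : q < r) : y.req q r + (if q ∈ y.prom r then 1 else 0) + y.gra r q =
      (if r ∈ y.need q then 1 else 0) := by
  have h0 := hx.req_count q r hqr
  have h1 := hx.away_count q r hqr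
  have h2 := hx.need_nbh q r
  have h3 := hx.prom_lt q r
  cases h using step_cases <;>
    grind (splits := 20) [Function.update_apply, send, receive, State.higherNbh]

theorem step_away_count {AE : Set P} {x y : State P} (h : step AE x y) (hx : Invariant x)
    (q r : P) (hqr : q < r) : (if q ∈ y.away r then 1 else 0) + (if r ∈ y.need q then 1 else 0) =
      y.gra r q + y.gra q r + (if 14 ≤ y.pc q ∧ r ∈ y.nbh q then 1 else 0) := by
  have h0 := hx.req_count q r hqr
  have h1 := hx.away_count q r hqr
  have h2 := hx.need_nbh q r
  have h3 := hx.prom_lt q r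
  cases h using step_cases <;>
    grind (splits := 20) [Function.update_apply, send, receive, State.higherNbh]

theorem Invariant.step {AE : Set P} {x y : State P} (hx : Invariant x) (h : step AE x y) :
    Invariant y where
  pc_ge := step_pc_ge h hx
  pc_le := step_pc_le h hx
  self_notMem_nbh := step_self_notMem_nbh h hx
  wack_eq_empty := step_wack_eq_empty h hx
  prio_eq_empty := step_prio_eq_empty h hx
  prio_before := step_prio_before h hx
  notify_count := step_notify_count h hx
  withdraw_count := step_withdraw_count h hx
  need_nbh := step_need_nbh h hx
  need_away := step_need_away h hx
  req_lt := step_req_lt h hx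
  prom_lt := step_prom_lt h hx
  req_count := step_req_count h hx
  away_count := step_away_count h hx

/-! ### Persistence of messages and flags under one step -/

theorem step_pc {AE : Set P} {x y : State P} (h : step AE x y) (p : P) :
    y.pc p = 11 ∨ x.pc p ≤ y.pc p := by
  cases h using step_cases <;>
    grind (splits := 20) [Function.update_apply, send, receive, State.higherNbh]

theorem step_nbh {AE : Set P} {x y : State P} (h : step AE x y) {p : P} (hp : y.pc p = x.pc p) :
    y.nbh p = x.nbh p := by
  cases h using step_cases <;>
    grind (splits := 20) [Function.update_apply, send, receive, State.higherNbh]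

theorem step_wack {AE : Set P} {x y : State P} (h : step AE x y) {p : P} (hp : y.pc p = x.pc p) :
    y.wack p ⊆ x.wack p := by
  cases h using step_cases <;>
    grind (splits := 20) [Function.update_apply, send, receive, State.higherNbh]

theorem step_prio {AE : Set P} {x y : State P} (h : step AE x y) {p : P} (hp : y.pc p = x.pc p) :
    y.prio p ⊆ x.prio p := by
  cases h using step_cases <;>
    grind (splits := 20) [Function.update_apply, send, receive, State.higherNbh]

/-- A flag or message of a handshake persists until the next stage of the handshake is reached:
here, a registered notification until it is acknowledged. The lemmas up to `step_prom` are of the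
same kind. -/
theorem step_before {AE : Set P} {x y : State P} (h : step AE x y) {p q : P} (hq : q ∈ x.before p) :
    q ∈ y.before p ∨ 0 < y.ack p q := by
  cases h using step_cases <;>
    grind (splits := 20) [Function.update_apply, send, receive, State.higherNbh]

theorem step_after {AE : Set P} {x y : State P} (h : step AE x y) {p q : P} (hq : q ∈ x.after p) :
    q ∈ y.after p ∨ 0 < y.ack p q := by
  cases h using step_cases <;>
    grind (splits := 20) [Function.update_apply, send, receive, State.higherNbh]

theorem step_ack {AE : Set P} {x y : State P} (h : step AE x y) {p q : P} (hq : 0 < x.ack q p) :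
    0 < y.ack q p ∨ q ∉ y.wack p := by
  cases h using step_cases <;>
    grind (splits := 20) [Function.update_apply, send, receive, State.higherNbh]

theorem step_withdraw {AE : Set P} {x y : State P} (h : step AE x y)
    {p q : P} (hq : 0 < x.withdraw q p) : 0 < y.withdraw q p ∨ q ∉ y.prio p := by
  cases h using step_cases <;>
    grind (splits := 20) [Function.update_apply, send, receive, State.higherNbh]

theorem step_gra {AE : Set P} {x y : State P} (h : step AE x y) {p q : P} (hq : 0 < x.gra q p) :
    0 < y.gra q p ∨ q ∉ y.need p := by
  cases h using step_cases <;>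
    grind (splits := 20) [Function.update_apply, send, receive, State.higherNbh]

theorem step_prom {AE : Set P} {x y : State P} (h : step AE x y) {p q : P} (hq : q ∈ x.prom p) :
    q ∈ y.prom p ∨ 0 < y.gra p q := by
  cases h using step_cases <;>
    grind (splits := 20) [Function.update_apply, send, receive, State.higherNbh]

/-- A fork is only given away by sending a grant. -/
theorem step_away {AE : Set P} {x y : State P} (h : step AE x y) {p q : P} (hq : q ∈ y.away p) :
    q ∈ x.away p ∨ 0 < y.gra p q := by
  cases h using step_cases <;>
    grind (splits := 20) [Function.update_apply, send, receive, State.higherNbh]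

/-- At line 14, the need for a fork of a higher process never arises anew: promises are given only
to lower processes. -/
theorem step_need {AE : Set P} {x y : State P} (h : step AE x y) (hx : Invariant x)
    {p q : P} (hpq : p < q) (hp : x.pc p = 14) (hq : q ∈ y.need p) : q ∈ x.need p := by
  have h0 := hx.prom_lt p q
  cases h using step_cases <;>
    grind (splits := 20) [Function.update_apply, send, receive, State.higherNbh]

/-- Once `p` is registered at `q` as a competitor that has not withdrawn, `q` cannot newly reach a
line from 13 on with `p` among its neighbours and no obligation to wait for `p`. -/
theorem step_overtake {AE : Set P} {x y : State P} (h : step AE x y)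
    {p q : P} (hb : p ∈ x.before q) (ha : p ∉ x.after q)
    (hw : x.withdraw p q = 0) (hy : 13 ≤ y.pc q ∧ p ∈ y.nbh q ∧ p ∉ y.prio q) :
    13 ≤ x.pc q ∧ p ∈ x.nbh q ∧ p ∉ x.prio q := by
  cases h using step_cases <;>
    grind (splits := 20) [Function.update_apply, send, receive, State.higherNbh]

/-- If one process enters line 13, then no other process moves in the same step. -/
theorem step_pc_of_ne {AE : Set P} {x y : State P} (h : step AE x y)
    {p q : P} (hp : x.pc p ≠ 13) (hp' : y.pc p = 13) (hq : q ≠ p) : y.pc q = x.pc q := by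
  cases h using step_cases <;>
    grind (splits := 20) [Function.update_apply, send, receive, State.higherNbh]

/-! ### Eventuality and fairness -/

theorem eventually_succ {Q : ℕ → Prop} (h : ∀ᶠ n in atTop, Q n) :
    ∀ᶠ n in atTop, Q (n + 1) :=
  (tendsto_add_atTop_nat 1).eventually h

/-- A predicate that is eventually preserved by every step is eventually always true or eventually
always false. -/
theorem eventually_or_eventually_not {Q : ℕ → Prop}
    (h : ∀ᶠ n in atTop, Q n → Q (n + 1)) :
    (∀ᶠ n in atTop, Q n) ∨ ∀ᶠ n in atTop, ¬ Q n := by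
  obtain ⟨k, hk⟩ := eventually_atTop.1 h
  by_cases hQ : ∃ m ≥ k, Q m
  · obtain ⟨m, hm, hQm⟩ := hQ
    refine .inl (eventually_atTop.2 ⟨m, fun n hn => ?_⟩)
    induction n, hn using Nat.le_induction with
    | base => exact hQm
    | succ n hn ih => exact hk n (hm.trans hn) ih
  · push Not at hQ
    exact .inr (eventually_atTop.2 ⟨k, hQ⟩)

theorem eventually_eq_empty {α : Type*} {S : ℕ → Finset α} (T : Finset α)
    (hT : ∀ᶠ n in atTop, S n ⊆ T) (h : ∀ q ∈ T, ∀ᶠ n in atTop, q ∉ S n) :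
    ∀ᶠ n in atTop, S n = ∅ := by
  filter_upwards [hT, (eventually_all_finset T).2 h] with n h1 h2
  exact Finset.eq_empty_of_forall_notMem fun q hq => h2 q (h1 hq) hq

/-- A weakly fair relation that is eventually always enabled is taken infinitely often. -/
theorem frequently_of_wf {X : Type*} {R : X → X → Prop} {xs : ℕ → X} (h : xs ∈ wf R)
    (he : ∀ᶠ n in atTop, ∃ y, R (xs n) y) : ∃ᶠ n in atTop, R (xs n) (xs (n + 1)) := by
  rcases h with h | h
  · obtain ⟨k, hk⟩ := eventually_atTop.1 he
    obtain ⟨j, hj⟩ := h k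
    obtain ⟨y, hy⟩ := hk (k + j) (Nat.le_add_right k j)
    exact (hj y hy).elim
  · refine frequently_atTop.2 fun k => ?_
    obtain ⟨j, hj⟩ := h k
    exact ⟨k + j, Nat.le_add_right k j, hj⟩

/-! ### Fair runs -/

section Run

variable {AE : Set P} {xs : ℕ → State P}

theorem step_of_mem_WF (h : xs ∈ WF AE) (n : ℕ) : step AE (xs n) (xs (n + 1)) :=
  h.1.1.2 n

theorem invariant_of_mem_WF (h : xs ∈ WF AE) (n : ℕ) : Invariant (xs n) := by
  induction n with
  | zero =>
    have h0 : xs 0 = initState := h.1.1.1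
    exact h0 ▸ invariant_initState
  | succ n ih => exact ih.step (step_of_mem_WF h n)

theorem frequently_fwd (h : xs ∈ WF AE) {p : P}
    (he : ∀ᶠ n in atTop, ∃ y, fwd p (xs n) y) :
    ∃ᶠ n in atTop, fwd p (xs n) (xs (n + 1)) :=
  frequently_of_wf (Set.mem_iInter.1 h.1.2 p) he

theorem frequently_rcv (h : xs ∈ WF AE) {p q : P} (m : Alt)
    (he : ∀ᶠ n in atTop, ∃ y, rcv m q p (xs n) y) :
    ∃ᶠ n in atTop, rcv m q p (xs n) (xs (n + 1)) :=
  frequently_of_wf (Set.mem_iInter.1 (Set.mem_iInter.1 (Set.mem_iInter.1 h.2 p) q) m) he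

/-- The seven lemmas from here on state the effects of fair reception: if an alternative of the
receiving component is eventually always enabled, its effect is observed infinitely often. -/
theorem frequently_mem_before (h : xs ∈ WF AE) {p q : P}
    (he : ∀ᶠ n in atTop, 0 < (xs n).notify q p) : ∃ᶠ n in atTop, q ∈ (xs n).before p := by
  refine frequently_atTop.2 fun k => ?_
  obtain ⟨n, hn, -, hxy⟩ := frequently_atTop.1
    (frequently_rcv h .notify (he.mono fun n hn => ⟨_, hn, rfl⟩)) k
  exact ⟨n + 1, by omega, by simp [hxy]⟩

theorem frequently_mem_after (h : xs ∈ WF AE) {p q : P}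
    (he : ∀ᶠ n in atTop, 0 < (xs n).withdraw q p) :
    ∃ᶠ n in atTop, q ∈ (xs n).after p ∧ q ∉ (xs n).prio p := by
  refine frequently_atTop.2 fun k => ?_
  obtain ⟨n, hn, -, hxy⟩ := frequently_atTop.1
    (frequently_rcv h .withdraw (he.mono fun n hn => ⟨_, hn, rfl⟩)) k
  exact ⟨n + 1, by omega, by simp [hxy]⟩

theorem frequently_ack_pos (h : xs ∈ WF AE) {p q : P}
    (he : ∀ᶠ n in atTop, q ∈ (xs n).after p ∧ q ∈ (xs n).before p) :
    ∃ᶠ n in atTop, 0 < (xs n).ack p q := by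
  refine frequently_atTop.2 fun k => ?_
  obtain ⟨n, hn, -, hxy⟩ := frequently_atTop.1
    (frequently_rcv h .after (he.mono fun n hn => ⟨_, Finset.mem_inter.2 hn, rfl⟩)) k
  exact ⟨n + 1, by omega, by simp [hxy, send]⟩

theorem frequently_notMem_wack (h : xs ∈ WF AE) {p q : P}
    (he : ∀ᶠ n in atTop, 0 < (xs n).ack q p) : ∃ᶠ n in atTop, q ∉ (xs n).wack p := by
  refine frequently_atTop.2 fun k => ?_
  obtain ⟨n, hn, -, hxy⟩ := frequently_atTop.1
    (frequently_rcv h .ack (he.mono fun n hn => ⟨_, hn, rfl⟩)) k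
  exact ⟨n + 1, by omega, by simp [hxy]⟩

theorem frequently_mem_prom (h : xs ∈ WF AE) {p q : P}
    (he : ∀ᶠ n in atTop, 0 < (xs n).req q p) : ∃ᶠ n in atTop, q ∈ (xs n).prom p := by
  refine frequently_atTop.2 fun k => ?_
  obtain ⟨n, hn, -, hxy⟩ := frequently_atTop.1
    (frequently_rcv h .req (he.mono fun n hn => ⟨_, hn, rfl⟩)) k
  exact ⟨n + 1, by omega, by simp [hxy]⟩

theorem frequently_notMem_away (h : xs ∈ WF AE) {p q : P}
    (he : ∀ᶠ n in atTop, 0 < (xs n).gra q p) :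
    ∃ᶠ n in atTop, q ∉ (xs n).away p ∧ q ∉ (xs n).need p := by
  refine frequently_atTop.2 fun k => ?_
  obtain ⟨n, hn, -, hxy⟩ := frequently_atTop.1
    (frequently_rcv h .gra (he.mono fun n hn => ⟨_, hn, rfl⟩)) k
  exact ⟨n + 1, by omega, by simp [hxy]⟩

theorem frequently_gra_pos (h : xs ∈ WF AE) {p q : P}
    (he : ∀ᶠ n in atTop, (q ∈ (xs n).prom p ∧ q ∉ (xs n).away p) ∧
      ¬ (15 ≤ (xs n).pc p ∧ q ∈ (xs n).nbh p)) :
    ∃ᶠ n in atTop, 0 < (xs n).gra p q := by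
  refine frequently_atTop.2 fun k => ?_
  obtain ⟨n, hn, -, -, hxy⟩ := frequently_atTop.1
    (frequently_rcv h .prom (he.mono fun n hn => ⟨_, Finset.mem_sdiff.2 hn.1, hn.2, rfl⟩)) k
  exact ⟨n + 1, by omega, by simp [hxy, send]⟩

theorem pc_ne_of_fwd {p : P} {x y : State P} (h : fwd p x y) : y.pc p ≠ x.pc p := by
  rcases h with ⟨h, -, rfl⟩ | ⟨h, -, rfl⟩ | ⟨h, -, rfl⟩ | ⟨h, rfl⟩ | ⟨h, rfl⟩ <;> simp [h]

/-- Every forward step changes the line, so a process that remains at one line has its forward step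
disabled infinitely often. -/
theorem not_eventually_fwd_enabled (h : xs ∈ WF AE) {p : P} {c : ℕ}
    (hc : ∀ᶠ n in atTop, (xs n).pc p = c) : ¬ ∀ᶠ n in atTop, ∃ y, fwd p (xs n) y := by
  intro he
  obtain ⟨n, h1, h2, h3⟩ := ((frequently_fwd h he).and_eventually
    (hc.and (eventually_succ hc))).exists
  exact pc_ne_of_fwd h1 (h3.trans h2.symm)

theorem exists_eventually_pc_eq (h : xs ∈ WF AE) {p : P}
    (hp : ∀ᶠ n in atTop, (xs n).pc p ≠ 11) :
    ∃ c, 12 ≤ c ∧ c ≤ 16 ∧ ∀ᶠ n in atTop, (xs n).pc p = c := by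
  have hd (c : ℕ) : (∀ᶠ n in atTop, c ≤ (xs n).pc p) ∨ ∀ᶠ n in atTop, ¬ c ≤ (xs n).pc p := by
    refine eventually_or_eventually_not ?_
    filter_upwards [eventually_succ hp] with n hn hcn
    have := step_pc (step_of_mem_WF h n) p
    omega
  have h12 : ∀ᶠ n in atTop, 12 ≤ (xs n).pc p := by
    filter_upwards [hp] with n hn
    have := (invariant_of_mem_WF h n).pc_ge p
    omega
  have h17 : ¬ ∀ᶠ n in atTop, 17 ≤ (xs n).pc p := fun h' => by
    obtain ⟨n, hn⟩ := h'.exists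
    have := (invariant_of_mem_WF h n).pc_le p
    omega
  obtain ⟨c, hc, h1, h2⟩ : ∃ c, 12 ≤ c ∧ (∀ᶠ n in atTop, c ≤ (xs n).pc p) ∧
      ¬ ∀ᶠ n in atTop, c + 1 ≤ (xs n).pc p := by
    by_contra! hcon
    exact h17 (Nat.le_induction h12 (fun c hc ih => hcon c hc ih) 17 (by norm_num))
  have h3 := (hd (c + 1)).resolve_left h2
  have h4 : ∀ᶠ n in atTop, (xs n).pc p = c := by
    filter_upwards [h1, h3] with n _ _
    omega
  obtain ⟨n, hn⟩ := h4.exists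
  exact ⟨c, hc, hn ▸ (invariant_of_mem_WF h n).pc_le p, h4⟩

/-! ### Lines 15 and 16 -/

theorem not_eventually_pc_eq_fifteen (h : xs ∈ WF AE) (p : P) :
    ¬ ∀ᶠ n in atTop, (xs n).pc p = 15 := fun hc =>
  not_eventually_fwd_enabled h hc <| hc.mono fun _ hn =>
    ⟨_, .inr <| .inr <| .inr <| .inl ⟨hn, rfl⟩⟩

theorem not_eventually_pc_eq_sixteen (h : xs ∈ WF AE) (p : P) :
    ¬ ∀ᶠ n in atTop, (xs n).pc p = 16 := fun hc =>
  not_eventually_fwd_enabled h hc <| hc.mono fun _ hn =>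
    ⟨_, .inr <| .inr <| .inr <| .inr ⟨hn, rfl⟩⟩

/-! ### Line 12 -/

theorem eventually_notMem_wack (h : xs ∈ WF AE) {p : P}
    (hc : ∀ᶠ n in atTop, (xs n).pc p = 12) (q : P) : ∀ᶠ n in atTop, q ∉ (xs n).wack p := by
  rcases eventually_or_eventually_not (Q := fun n => q ∉ (xs n).wack p) (by
    filter_upwards [hc, eventually_succ hc] with n h1 h2 h3 h4
    exact h3 (step_wack (step_of_mem_WF h n) (h2.trans h1.symm) h4)) with hw | hw
  · exact hw
  exfalso
  simp only [not_not] at hw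
  have hA : ∀ᶠ n in atTop, ¬ 0 < (xs n).ack q p := by
    refine (eventually_or_eventually_not ?_).resolve_left fun hpos => ?_
    · filter_upwards [eventually_succ hw] with n h1 h2
      exact (step_ack (step_of_mem_WF h n) h2).resolve_right (not_not.2 h1)
    · obtain ⟨n, h1, h2⟩ := ((frequently_notMem_wack h hpos).and_eventually hw).exists
      exact h1 h2
  have hB : ∀ᶠ n in atTop, p ∈ (xs n).before q := by
    refine (eventually_or_eventually_not ?_).resolve_right fun hno => ?_
    · filter_upwards [eventually_succ hA] with n h1 h2
      exact (step_before (step_of_mem_WF h n) h2).resolve_right h1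
    · refine frequently_mem_before h (q := p) (p := q) ?_ hno
      filter_upwards [hno, hw, hA, hc] with n h1 h2 h3 h4
      have := (invariant_of_mem_WF h n).notify_count p q
      simp only [h1, h2, if_true, if_false] at this
      omega
  have hF : ∀ᶠ n in atTop, p ∈ (xs n).after q := by
    refine (eventually_or_eventually_not ?_).resolve_right fun hno => ?_
    · filter_upwards [eventually_succ hA] with n h1 h2
      exact (step_after (step_of_mem_WF h n) h2).resolve_right h1
    · refine frequently_mem_after h (q := p) (p := q) ?_ (hno.mono fun n h1 h2 => h1 h2.1)
      filter_upwards [hno, hw, hA] with n h1 h2 h3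
      have := (invariant_of_mem_WF h n).withdraw_count p q
      simp only [h1, h2, if_true, if_false] at this
      omega
  exact frequently_ack_pos h (hF.and hB) hA

theorem exists_eventually_subset {c : ℕ} {p : P} {S : State P → Finset P} (h : xs ∈ WF AE)
    (hS : ∀ {x y : State P}, step AE x y → y.pc p = x.pc p → S y ⊆ S x)
    (hc : ∀ᶠ n in atTop, (xs n).pc p = c) : ∃ T, ∀ᶠ n in atTop, S (xs n) ⊆ T := by
  obtain ⟨k, hk⟩ := eventually_atTop.1 hc
  refine ⟨S (xs k), eventually_atTop.2 ⟨k, fun n hn => ?_⟩⟩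
  induction n, hn using Nat.le_induction with
  | base => exact subset_rfl
  | succ n hn ih =>
    exact (hS (step_of_mem_WF h n) ((hk _ (by omega)).trans (hk n hn).symm)).trans ih

theorem not_eventually_pc_eq_twelve (h : xs ∈ WF AE) (p : P) :
    ¬ ∀ᶠ n in atTop, (xs n).pc p = 12 := by
  intro hc
  obtain ⟨T, hT⟩ := exists_eventually_subset (S := fun x => x.wack p) h
    (fun hs => step_wack hs) hc
  have he := eventually_eq_empty T hT fun q _ => eventually_notMem_wack h hc q
  exact not_eventually_fwd_enabled h hc <| (hc.and he).mono fun _ hn =>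
    ⟨_, .inl ⟨hn.1, hn.2, rfl⟩⟩

/-! ### Line 14 -/

/-- If `p` remains at line 14, its notification eventually reaches each neighbour `q` for good,
without a withdrawal. -/
theorem eventually_mem_before (h : xs ∈ WF AE) {p q : P}
    (hc : ∀ᶠ n in atTop, (xs n).pc p = 14) (hq : ∀ᶠ n in atTop, q ∈ (xs n).nbh p) :
    ∀ᶠ n in atTop, p ∈ (xs n).before q ∧ p ∉ (xs n).after q ∧ (xs n).withdraw p q = 0 := by
  have hw : ∀ᶠ n in atTop, (xs n).withdraw p q + (if p ∈ (xs n).after q then 1 else 0) +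
      (xs n).ack q p = 0 := by
    filter_upwards [hc] with n hn
    have hi := invariant_of_mem_WF h n
    rw [hi.withdraw_count p q, hi.wack_eq_empty p (.inr hn)]
    simp
  have hB : ∀ᶠ n in atTop, p ∈ (xs n).before q := by
    refine (eventually_or_eventually_not ?_).resolve_right fun hno => ?_
    · filter_upwards [eventually_succ hw] with n h1 h2
      exact (step_before (step_of_mem_WF h n) h2).resolve_right (by omega)
    · refine frequently_mem_before h (q := p) (p := q) ?_ hno
      filter_upwards [hno, hw, hc, hq] with n h1 h2 h3 h4
      have := (invariant_of_mem_WF h n).notify_count p q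
      simp only [h1, h3, h4, if_false, or_true, and_self, if_true] at this
      omega
  filter_upwards [hB, hw] with n h1 h2
  refine ⟨h1, fun h3 => ?_, by omega⟩
  simp [h3] at h2

/-- If `p` remains at line 14, a neighbour `q` of `p` eventually never competes with `p` at line 14
or later, unless `q` gets stuck itself. -/
theorem eventually_overtake (h : xs ∈ WF AE) {p q : P}
    (hc : ∀ᶠ n in atTop, (xs n).pc p = 14) (hq : ∀ᶠ n in atTop, q ∈ (xs n).nbh p) :
    (∀ᶠ n in atTop, ¬ (14 ≤ (xs n).pc q ∧ p ∈ (xs n).nbh q)) ∨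
      (∀ᶠ n in atTop, (xs n).pc q = 13) ∨ ∀ᶠ n in atTop, (xs n).pc q = 14 := by
  have hb := eventually_mem_before h hc hq
  rcases eventually_or_eventually_not
    (Q := fun n => ¬ (13 ≤ (xs n).pc q ∧ p ∈ (xs n).nbh q ∧ p ∉ (xs n).prio q)) (by
      filter_upwards [hb] with n h1 h2 h3
      exact h2 (step_overtake (step_of_mem_WF h n) h1.1 h1.2.1 h1.2.2 h3)) with hH | hH
  · refine .inl ?_
    filter_upwards [hH] with n h1 h2
    refine h1 ⟨by omega, h2.2, ?_⟩
    rw [(invariant_of_mem_WF h n).prio_eq_empty q (by omega)]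
    exact Finset.notMem_empty p
  · simp only [not_not] at hH
    obtain ⟨c, -, h16, he⟩ := exists_eventually_pc_eq h (p := q) (hH.mono fun n hn => by omega)
    obtain ⟨n, h1, h2⟩ := (hH.and he).exists
    have h15 : c ≠ 15 := by rintro rfl; exact not_eventually_pc_eq_fifteen h q he
    have h16' : c ≠ 16 := by rintro rfl; exact not_eventually_pc_eq_sixteen h q he
    obtain rfl | rfl : c = 13 ∨ c = 14 := by omega
    · exact .inr (.inl he)
    · exact .inr (.inr he)

/-- A process that remains at line 14 gets the forks of its higher neighbours. -/
theorem eventually_notMem_need_of_gt (h : xs ∈ WF AE) {p q : P} (hpq : p < q)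
    (hc : ∀ᶠ n in atTop, (xs n).pc p = 14) (hq : ∀ᶠ n in atTop, q ∈ (xs n).nbh p) :
    ∀ᶠ n in atTop, q ∉ (xs n).need p := by
  rcases eventually_or_eventually_not (Q := fun n => q ∉ (xs n).need p) (by
    filter_upwards [hc] with n h1 h2 h3
    exact h2 (step_need (step_of_mem_WF h n) (invariant_of_mem_WF h n) hpq h1 h3)) with hw | hw
  · exact hw
  exfalso
  simp only [not_not] at hw
  have h15 : ∀ᶠ n in atTop, ¬ (15 ≤ (xs n).pc q ∧ p ∈ (xs n).nbh q) := by
    rcases eventually_overtake h hc hq with h1 | h1 | h1 <;> filter_upwards [h1] with n hn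
    · exact fun h2 => hn ⟨by omega, h2.2⟩
    all_goals omega
  have hG : ∀ᶠ n in atTop, ¬ 0 < (xs n).gra q p := by
    refine (eventually_or_eventually_not ?_).resolve_left fun hpos => ?_
    · filter_upwards [eventually_succ hw] with n h1 h2
      exact (step_gra (step_of_mem_WF h n) h2).resolve_right (not_not.2 h1)
    · exact frequently_notMem_away h hpos (hw.mono fun n h1 h2 => h2.2 h1)
  have hP : ∀ᶠ n in atTop, p ∈ (xs n).prom q := by
    refine (eventually_or_eventually_not ?_).resolve_right fun hno => ?_
    · filter_upwards [eventually_succ hG] with n h1 h2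
      exact (step_prom (step_of_mem_WF h n) h2).resolve_right h1
    · refine frequently_mem_prom h ?_ hno
      filter_upwards [hno, hw, hG] with n h1 h2 h3
      have := (invariant_of_mem_WF h n).req_count p q hpq
      simp only [h1, h2, if_true, if_false] at this
      omega
  have hA : ∀ᶠ n in atTop, p ∉ (xs n).away q := by
    refine (eventually_or_eventually_not ?_).resolve_right fun hno => ?_
    · filter_upwards [eventually_succ hG] with n h1 h2 h3
      exact h2 ((step_away (step_of_mem_WF h n) h3).resolve_right h1)
    · simp only [not_not] at hno
      refine frequently_notMem_away h (q := p) (p := q) ?_ (hno.mono fun n h1 h2 => h2.1 h1)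
      filter_upwards [hno, hw, hG, hc, hq] with n h1 h2 h3 h4 h5
      have := (invariant_of_mem_WF h n).away_count p q hpq
      simp only [h1, h2, h4, h5, le_refl, and_self, if_true] at this
      omega
  exact frequently_gra_pos h ((hP.and hA).and h15) hG

/-- If the lower process `q` eventually never claims the fork that it shares with `p`, then `p` gets
it back for good. -/
theorem eventually_notMem_need_of_lt (h : xs ∈ WF AE) {p q : P} (hqp : q < p)
    (hL : ∀ᶠ n in atTop, ¬ (14 ≤ (xs n).pc q ∧ p ∈ (xs n).nbh q)) :
    ∀ᶠ n in atTop, q ∉ (xs n).need p := by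
  have hN : ∀ᶠ n in atTop, p ∉ (xs n).need q := by
    filter_upwards [hL] with n h1 h2
    have := (invariant_of_mem_WF h n).need_nbh q p h2
    exact h1 ⟨this.1.ge, this.2⟩
  have hG : ∀ᶠ n in atTop, ¬ 0 < (xs n).gra p q := by
    filter_upwards [hN] with n h1
    have := (invariant_of_mem_WF h n).req_count q p hqp
    simp only [h1, if_false] at this
    omega
  have hA : ∀ᶠ n in atTop, q ∉ (xs n).away p := by
    refine (eventually_or_eventually_not ?_).resolve_right fun hno => ?_
    · filter_upwards [eventually_succ hG] with n h1 h2 h3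
      exact h2 ((step_away (step_of_mem_WF h n) h3).resolve_right h1)
    · simp only [not_not] at hno
      refine frequently_notMem_away h (q := q) (p := p) ?_ (hno.mono fun n h1 h2 => h2.1 h1)
      filter_upwards [hno, hN, hG, hL] with n h1 h2 h3 h4
      have := (invariant_of_mem_WF h n).away_count q p hqp
      simp only [h1, h2, h4, if_true, if_false] at this
      omega
  filter_upwards [hA] with n h1 h2
  exact h1 ((invariant_of_mem_WF h n).need_away p q h2 hqp)

theorem not_eventually_pc_eq_fourteen [WellFoundedLT P] (h : xs ∈ WF AE) (p : P) :
    ¬ ∀ᶠ n in atTop, (xs n).pc p = 14 := by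
  induction p using WellFoundedLT.induction with
  | ind p ih =>
  intro hc
  obtain ⟨k, hk⟩ := eventually_atTop.1 hc
  have hnbh : ∀ n ≥ k, (xs n).nbh p = (xs k).nbh p := fun n hn => by
    induction n, hn using Nat.le_induction with
    | base => rfl
    | succ n hn ih =>
      rw [step_nbh (step_of_mem_WF h n) ((hk _ (by omega)).trans (hk n hn).symm), ih]
  have he : ∀ᶠ n in atTop, (xs n).need p = ∅ := by
    refine eventually_eq_empty ((xs k).nbh p) (eventually_atTop.2 ⟨k, fun n hn q hq => ?_⟩)
      fun q hq => ?_
    · exact hnbh n hn ▸ ((invariant_of_mem_WF h n).need_nbh p q hq).2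
    · have hq' : ∀ᶠ n in atTop, q ∈ (xs n).nbh p :=
        eventually_atTop.2 ⟨k, fun n hn => hnbh n hn ▸ hq⟩
      rcases lt_trichotomy p q with hpq | rfl | hqp
      · exact eventually_notMem_need_of_gt h hpq hc hq'
      · exact ((invariant_of_mem_WF h k).self_notMem_nbh p hq).elim
      · refine eventually_notMem_need_of_lt h hqp ?_
        rcases eventually_overtake h hc hq' with h1 | h1 | h1
        · exact h1
        · filter_upwards [h1] with n hn
          omega
        · exact (ih q hqp h1).elim
  exact not_eventually_fwd_enabled h hc <| (hc.and he).mono fun _ hn =>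
    ⟨_, .inr <| .inr <| .inl ⟨hn.1, hn.2, rfl⟩⟩

/-! ### Line 13 -/

/-- A process that remains at line 13 waits forever for some fixed process, since its finite set
`prio` can only shrink there. -/
theorem exists_forall_mem_prio (h : xs ∈ WF AE) {p : P} {k : ℕ}
    (hk : ∀ n ≥ k, (xs n).pc p = 13) : ∃ q, ∀ n ≥ k, q ∈ (xs n).prio p := by
  by_contra! hcon
  have hc : ∀ᶠ n in atTop, (xs n).pc p = 13 := eventually_atTop.2 ⟨k, hk⟩
  obtain ⟨T, hT⟩ := exists_eventually_subset (S := fun x => x.prio p) h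
    (fun hs => step_prio hs) hc
  have he := eventually_eq_empty T hT fun q _ => by
    obtain ⟨m, hm, hq⟩ := hcon q
    refine eventually_atTop.2 ⟨m, fun n hn => ?_⟩
    induction n, hn using Nat.le_induction with
    | base => exact hq
    | succ n hn ih =>
      exact fun h' => ih (step_prio (step_of_mem_WF h n)
        ((hk _ (by omega)).trans (hk n (by omega)).symm) h')
  exact not_eventually_fwd_enabled h hc <| (hc.and he).mono fun _ hn =>
    ⟨_, .inr <| .inl ⟨hn.1, hn.2, rfl⟩⟩

theorem withdraw_eq_zero_of_forall_mem_prio (h : xs ∈ WF AE) {p q : P} {k : ℕ}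
    (hk : ∀ n ≥ k, q ∈ (xs n).prio p) {n : ℕ} (hn : k ≤ n) : (xs n).withdraw q p = 0 := by
  by_contra hpos
  have hw : ∀ m ≥ n, 0 < (xs m).withdraw q p := fun m hm => by
    induction m, hm using Nat.le_induction with
    | base => exact Nat.pos_of_ne_zero hpos
    | succ m hm ih =>
      exact (step_withdraw (step_of_mem_WF h m) ih).resolve_right
        (not_not.2 (hk (m + 1) (by omega)))
  exact frequently_mem_after h (eventually_atTop.2 ⟨n, hw⟩)
    (eventually_atTop.2 ⟨k, fun m hm h' => h'.2 (hk m hm)⟩)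

/-- No process remains at line 13 from time `k` on. The induction on `k` works because the process
that is waited for has been at line 13 for longer. -/
theorem not_forall_pc_eq_thirteen [WellFoundedLT P] (h : xs ∈ WF AE) (k : ℕ) (p : P) :
    ¬ ∀ n ≥ k, (xs n).pc p = 13 := by
  induction k generalizing p with
  | zero =>
    intro hk
    have h0 : xs 0 = initState := h.1.1.1
    have := hk 0 le_rfl
    simp [h0, initState] at this
  | succ k ih =>
    intro hk
    -- By the induction hypothesis, `p` enters line 13 exactly at time `k + 1`.
    have hpk : (xs k).pc p ≠ 13 := fun h0 => ih p fun n hn => by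
      rcases hn.eq_or_lt with rfl | hn
      exacts [h0, hk n hn]
    obtain ⟨q, hq⟩ := exists_forall_mem_prio h hk
    have hqn : ∀ n ≥ k + 1, ((xs n).pc q = 13 ∨ (xs n).pc q = 14) ∧ p ∈ (xs n).nbh q := by
      intro n hn
      by_contra hM
      have hi := invariant_of_mem_WF h n
      have hb := hi.prio_before p q (hq n hn)
      have h1 := hi.notify_count q p
      have h2 := hi.withdraw_count q p
      simp only [withdraw_eq_zero_of_forall_mem_prio h hq hn, hb.1, hb.2, hM, if_true,
        if_false] at h1 h2
      omega
    have hne : q ≠ p := by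
      rintro rfl
      exact (invariant_of_mem_WF h _).self_notMem_nbh q (hqn _ le_rfl).2
    -- The step to time `k + 1` is one of `p`, so `q` was at its line already at time `k`.
    have hqk : ∀ n ≥ k, (xs n).pc q = 13 ∨ (xs n).pc q = 14 := fun n hn => by
      rcases hn.eq_or_lt with rfl | hn
      · rw [← step_pc_of_ne (step_of_mem_WF h k) hpk (hk _ le_rfl) hne]
        exact (hqn _ le_rfl).1
      · exact (hqn n hn).1
    refine ih q fun n hn => (hqk n hn).resolve_right fun h14 => ?_
    refine not_eventually_pc_eq_fourteen h q (eventually_atTop.2 ⟨n, fun m hm => ?_⟩)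
    induction m, hm using Nat.le_induction with
    | base => exact h14
    | succ m hm ih' =>
      have h1 := step_pc (step_of_mem_WF h m) q
      have h2 := hqk (m + 1) (by omega)
      omega

/-! ### Starvation freedom -/

theorem frequently_pc_eq_eleven [WellFoundedLT P] (h : xs ∈ WF AE) (p : P) :
    ∃ᶠ n in atTop, (xs n).pc p = 11 := by
  intro hne
  obtain ⟨c, h12, h16, hc⟩ := exists_eventually_pc_eq h hne
  interval_cases c
  · exact not_eventually_pc_eq_twelve h p hc
  · obtain ⟨k, hk⟩ := eventually_atTop.1 hc
    exact not_forall_pc_eq_thirteen h k p hk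
  · exact not_eventually_pc_eq_fourteen h p hc
  · exact not_eventually_pc_eq_fifteen h p hc
  · exact not_eventually_pc_eq_sixteen h p hc

end Run

end PartialMX

theorem mainTheorem2 (Proc : Set ℕ) (AE : Set Proc) (p : Proc) :
    PartialMX.WF AE ⊆
      PartialMX.box (PartialMX.diamond (PartialMX.sem1 (PartialMX.atLine p 11))) := by
  intro xs hxs k
  obtain ⟨n, hn, hpc⟩ := Filter.frequently_atTop.1 (PartialMX.frequently_pc_eq_eleven hxs p) k
  refine ⟨n - k, ?_⟩
  have hkn : k + (n - k) = n := by omega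
  simpa [PartialMX.sem1, PartialMX.shift, PartialMX.atLine, hkn] using hpc
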